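/- Let $n\ge 0$, $N=\{1,\dots,n\}$, $\hat N=\{1,\dots,n+1\}$. Let $c_1,\dots,c_n$ be non-negative integers and let $\prec$ be a total order on $N$ such that $i\prec j$ implies $c_i\le c_j$; write $s_1\prec s_2\prec\dots\prec s_n$ for the elements of $N$. Let $r^1,\dots,r^{n+1}$ be linearly independent linear functions on a vector space over $\mathbb Q$. **The polytope.** $K(\mathbf c)\subset\mathbb Q^n$ is the set of all $(c'_1,\dots,c'_n)$ with $0\le c'_k\le c_k$ for all $k\in N$ and, for every $k\in N$, $$c'_{t_{i+1}}-c'_{t_i}\ \ge\ \min\{0,\;c_{t_{i+1}}-c_{t_i}\}\qquad (1\le i\le k-1),\tag{3}_k$$ where $t_1<t_2<\dots<t_k$ (natural order) are the elements of $\{s_1,\dots,s_k\}$. **The canonical $S$-graph.** $\mathscr G(\mathbf c)$ is the graph with vertex labels in $\hat N$ and edge labels in $N$ defined by binary fusion as follows. For $n=0$ it is a single vertex with label $1$. For $n\ge1$ let $s=s_n$, let $\mathbf c^-$ be obtained from $\mathbf c$ by deleting the index $s$ (keeping the order induced by $\prec$ on $N\setminus\{s\}$, and renumbering the remaining indices increasingly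 by $1,\dots,n-1$), and suppose that $\mathscr G(\mathbf c^-)$ is constructed. Let $\mathscr G^+$ and $\mathscr G^-$ be two disjoint copies of $\mathscr G(\mathbf c^-)$, with edge labels transported by the increasing bijection $\{1,\dots,n-1\}\to N\setminus\{s\}$, and with vertex labels transported by the increasing bijections $\{1,\dots,n\}\to\hat N\setminus\{s\}$ for $\mathscr G^+$ and $\{1,\dots,n\}\to\hat N\setminus\{s+1\}$ for $\mathscr G^-$. Then $\mathscr G(\mathbf c)$ is the union of $\mathscr G^+$ and $\mathscr G^-$ together with an edge labelled $s$ joining each vertex of $\mathscr G^+$ with label $s+1$ to the corresponding vertex of $\mathscr G^-$. **The functions $z_v$.** A pointed chain in $\mathscr G(\mathbf c)$ is a sequence of vertices $v_{n+1},v_n,\dots,v_1$ such that $v_k$ has label $k$ for all $k\in\hat N$ and $v_{k+1},v_k$ are joined by an edge labelled $k$ for all $k\in N$. An evaluation (with zero driving function) is a family $(z_v)$ of linear functions, indexed by the vertices $v$ of $\mathscr G(\mathbf c)$, such that $z_v-z_{v'}=c_m(r^k-r^\ell)$ whenever $v,v'$ have labels $k,\ell$ and are joined by an edge with label $m$, and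 such that $z_{v_{n+1}}=0$ for every pointed chain $v_{n+1},\dots,v_1$. **Theorem 1.4.** The graph $\mathscr G(\mathbf c)$ has exactly one pointed chain and exactly one evaluation $(z_v)$. Put $Z(\mathbf c)=\{z_v\}$, where $v$ runs over the vertices of $\mathscr G(\mathbf c)$. Identify $(c'_1,\dots,c'_n)\in\mathbb Q^n$ with the linear function $\sum_{k=1}^n c'_k(r^k-r^{k+1})$; this identification is injective. Then the set of extreme points of $K(\mathbf c)$ is exactly $Z(\mathbf c)$. -/

import Mathlib

/-- A finite graph whose vertices carry labels in `N̂ = {1, …, n+1}` and whose edges carry labels in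
`N = {1, …, n}` (both are indexed from `0` here, so that `i : Fin n` stands for `i + 1 ∈ N`).
`edge k` is the graph formed by the edges with label `k`. -/
structure LabelledGraph (n : ℕ) where
  V : Type
  finite : Finite V
  label : V → Fin (n + 1)
  edge : Fin n → SimpleGraph V

namespace LabelledGraph

/-- The graph with one vertex and no edges. -/
def point : LabelledGraph 0 where
  V := Unit
  finite := inferInstance
  label := fun _ => 0
  edge := fun _ => ⊥

/-- The edge relation, with label `k`, of the binary fusion at `s`. The summands `inl`, `inr` are
the vertex sets of `𝒢⁺`, `𝒢⁻`. Inside each of them the edges are those of `G`, with the edge labels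
moved by the increasing bijection `{1, …, n} → {1, …, n+1} ∖ {s}`; the new edges carry the label `s`
and join a vertex `v` of `𝒢⁺` with label `s+1` to the same vertex of `𝒢⁻`. -/
def fusionAdj {n : ℕ} (G : LabelledGraph n) (s k : Fin (n + 1)) : G.V ⊕ G.V → G.V ⊕ G.V → Prop
  | .inl v, .inl w => ∃ q, s.succAbove q = k ∧ (G.edge q).Adj v w
  | .inr v, .inr w => ∃ q, s.succAbove q = k ∧ (G.edge q).Adj v w
  | .inl v, .inr w => k = s ∧ v = w ∧ s.castSucc.succAbove (G.label v) = s.succ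
  | .inr v, .inl w => k = s ∧ v = w ∧ s.castSucc.succAbove (G.label v) = s.succ

/-- Binary fusion at `s`: two copies `𝒢⁺` (`inl`) and `𝒢⁻` (`inr`) of `G`. The vertex labels of
`𝒢⁺` are those of `G` moved by the increasing bijection onto the labels other than `s`, those of
`𝒢⁻` are those of `G` moved by the increasing bijection onto the labels other than `s+1`. -/
def fusion {n : ℕ} (G : LabelledGraph n) (s : Fin (n + 1)) : LabelledGraph (n + 1) where
  V := G.V ⊕ G.V
  finite := by
    have := G.finite
    infer_instance
  label := Sum.elim (fun v => s.castSucc.succAbove (G.label v))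
    (fun v => s.succ.succAbove (G.label v))
  edge := fun k =>
    { Adj := G.fusionAdj s k
      symm := ⟨by
        rintro (v | v) (w | w) h
        · obtain ⟨q, hq, h⟩ := h
          exact ⟨q, hq, h.symm⟩
        · obtain ⟨hk, rfl, h⟩ := h
          exact ⟨hk, rfl, h⟩
        · obtain ⟨hk, rfl, h⟩ := h
          exact ⟨hk, rfl, h⟩
        · obtain ⟨q, hq, h⟩ := h
          exact ⟨q, hq, h.symm⟩⟩
      loopless := ⟨by
        rintro (v | v) ⟨q, _, h⟩ <;> exact (G.edge q).irrefl h⟩ }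

/-- The identification `𝒢⁺ → 𝒢⁻` of vertices keeps all labels, except that `s+1` becomes `s`. -/
theorem fusion_label_inr {n : ℕ} (G : LabelledGraph n) (s : Fin (n + 1)) (v : G.V) :
    (G.fusion s).label (.inr v) =
      if (G.fusion s).label (.inl v) = s.succ then s.castSucc else (G.fusion s).label (.inl v) := by
  have key : ∀ k : Fin (n + 1), s.succ.succAbove k =
      if s.castSucc.succAbove k = s.succ then s.castSucc else s.castSucc.succAbove k := by
    intro k
    simp only [Fin.succAbove, Fin.lt_def, Fin.ext_iff]
    split_ifs <;> simp_all <;> omega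
  exact key (G.label v)

/-- A pointed chain: vertices `v_{n+1}, v_n, …, v_1` such that `v_k` has label `k` and such that
`v_{k+1}`, `v_k` are joined by an edge with label `k`. -/
def IsPointedChain {n : ℕ} (G : LabelledGraph n) (p : Fin (n + 1) → G.V) : Prop :=
  (∀ k, G.label (p k) = k) ∧ ∀ k : Fin n, (G.edge k).Adj (p k.succ) (p k.castSucc)

/-- An evaluation of `G` with zero driving function: a family of linear functions `z_v` such that
`z_v - z_{v'} = c_k (r^{label v} - r^{label v'})` whenever `v`, `v'` are joined by an edge with
label `k`, and such that `z` vanishes at the vertex of label `n+1` of a pointed chain. -/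
def IsEvaluation {n : ℕ} {B : Type*} [AddCommGroup B] [Module ℚ B] (G : LabelledGraph n)
    (c : Fin n → ℕ) (r : Fin (n + 1) → Module.Dual ℚ B) (z : G.V → Module.Dual ℚ B) : Prop :=
  (∀ (k : Fin n) (v v' : G.V), (G.edge k).Adj v v' →
      z v - z v' = (c k : ℚ) • (r (G.label v) - r (G.label v'))) ∧
    ∀ p, G.IsPointedChain p → z (p (Fin.last n)) = 0

end LabelledGraph

/-- The largest element of `{1, …, n+1}` for the strict total order `prec`. -/
noncomputable def largest {n : ℕ} (prec : Fin (n + 1) → Fin (n + 1) → Prop) : Fin (n + 1) :=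
  Classical.epsilon fun s => ∀ j, j ≠ s → prec j s

theorem largest_spec {n : ℕ} (prec : Fin (n + 1) → Fin (n + 1) → Prop)
    [IsStrictTotalOrder (Fin (n + 1)) prec] (j : Fin (n + 1)) (hj : j ≠ largest prec) :
    prec j (largest prec) := by
  have h : ∃ s, ∀ j, j ≠ s → prec j s := by
    obtain ⟨s, -, hs⟩ := (Finite.wellFounded_of_trans_of_irrefl (Function.swap prec)).has_min
      Set.univ Set.univ_nonempty
    refine ⟨s, fun j hj => ?_⟩
    rcases trichotomous_of prec j s with h | h | h
    · exact h
    · exact absurd h hj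
    · exact absurd h (hs j trivial)
  exact Classical.epsilon_spec h j hj

/-- The canonical `S`-graph `𝒢(𝐜)` attached to a strict total order `prec` on `N`: if `s` is the
largest element of `N`, it is the binary fusion at `s` of the canonical `S`-graph of the order
induced on `N ∖ {s}`, the latter being renumbered by closing up the gap at `s`. -/
noncomputable def canonicalGraph : (n : ℕ) → (Fin n → Fin n → Prop) → LabelledGraph n
  | 0, _ => LabelledGraph.point
  | n + 1, prec =>
      (canonicalGraph n fun i j =>
        prec ((largest prec).succAbove i) ((largest prec).succAbove j)).fusion (largest prec)

/-- `Z(𝐜)`: the set of the linear functions `z_v`, for `v` a vertex of the canonical `S`-graph. -/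
def ZSet {n : ℕ} {B : Type*} [AddCommGroup B] [Module ℚ B] (c : Fin n → ℕ)
    (prec : Fin n → Fin n → Prop) (r : Fin (n + 1) → Module.Dual ℚ B) : Set (Module.Dual ℚ B) :=
  {f | ∃ z, (canonicalGraph n prec).IsEvaluation c r z ∧ ∃ v, z v = f}

/-- The initial segment `{s_1, …, s_k}` of `N` for `s_1 ≺ ⋯ ≺ s_n`, given by its last element
`m = s_k`. -/
def initialSegment {n : ℕ} (prec : Fin n → Fin n → Prop) (m : Fin n) : Set (Fin n) :=
  {j | prec j m ∨ j = m}

/-- `i < j` are nearest neighbours in `S` for the natural order. -/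
def NearestNeighbours {n : ℕ} (S : Set (Fin n)) (i j : Fin n) : Prop :=
  i ∈ S ∧ j ∈ S ∧ i < j ∧ ∀ l ∈ S, ¬ (i < l ∧ l < j)

/-- The polytope `K(𝐜) ⊆ ℚⁿ`. -/
def KSet {n : ℕ} (c : Fin n → ℕ) (prec : Fin n → Fin n → Prop) : Set (Fin n → ℚ) :=
  {c' | (∀ k, 0 ≤ c' k ∧ c' k ≤ c k) ∧
    ∀ m i j, NearestNeighbours (initialSegment prec m) i j →
      min 0 ((c j : ℚ) - c i) ≤ c' j - c' i}

/-- The linear function `∑ c'_k (r^k - r^{k+1})` with coordinates `c' ∈ ℚⁿ`. -/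
def coordFunction {n : ℕ} {B : Type*} [AddCommGroup B] [Module ℚ B]
    (r : Fin (n + 1) → Module.Dual ℚ B) (c' : Fin n → ℚ) : Module.Dual ℚ B :=
  ∑ k : Fin n, c' k • (r k.castSucc - r k.succ)

/-! Everything is by induction on `n`, removing the largest index `s`. Since `c s` is maximal, the
inequalities on `c'_s` given the other coordinates `x` reduce to `L x ≤ c'_s ≤ U x`, where `L x` is
the left neighbour of `c'_s` (or `0`) and `U x` is its right neighbour plus `c_s - c_{s+1}` (with
`0` for a missing neighbour and its `c`). So `K(𝐜)` is the region between the graphs of two affine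
functions over `K(𝐜⁻)` (`mem_KSet_iff`), and its extreme points are the two lifts of those of
`K(𝐜⁻)` (`extremePoints_setOf_between`).

The lifts match the two copies in the fusion. The lift by `L` removes `r^s`, which is the
relabelling of `𝒢⁺`; the lift by `U` is the relabelling of `𝒢⁻` plus the constant `(c_s -
c_{s+1})(r^s - r^{s+1})`. Edges inside a copy are thus respected. For the new edges one carries an
invariant: in `z_v` the coefficient of `r^k`, `k` the label of `v`, is `c_k` (with `c_{n+1} = 0`).
This yields an evaluation in `exists_coordinates_isEvaluation`; uniqueness follows from
connectedness and the pointed chain. -/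

/-! ### Coordinates, coefficients, and insertion of a coordinate. -/

/-- The coefficient of `r^k` in `∑ c'_k (r^k - r^{k+1})`. -/
def dualCoeff {n : ℕ} (x : Fin n → ℚ) (k : Fin (n + 1)) : ℚ :=
  (Fin.snoc x 0 : Fin (n + 1) → ℚ) k - (Fin.cons 0 x : Fin (n + 1) → ℚ) k

theorem coordFunction_eq_sum {n : ℕ} {B : Type*} [AddCommGroup B] [Module ℚ B]
    (r : Fin (n + 1) → Module.Dual ℚ B) (x : Fin n → ℚ) :
    coordFunction r x = ∑ k, dualCoeff x k • r k := by
  simp only [coordFunction, dualCoeff, sub_smul, smul_sub, Finset.sum_sub_distrib]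
  rw [Fin.sum_univ_castSucc (fun k => (Fin.snoc x 0 : Fin (n + 1) → ℚ) k • r k),
    Fin.sum_univ_succ (fun k => (Fin.cons 0 x : Fin (n + 1) → ℚ) k • r k)]
  simp

/-- The coefficients are the successive differences of `x` extended by zeros, so they determine `x`
from the left. -/
theorem coordFunction_injective {n : ℕ} {B : Type*} [AddCommGroup B] [Module ℚ B]
    {r : Fin (n + 1) → Module.Dual ℚ B} (hr : LinearIndependent ℚ r) :
    Function.Injective (coordFunction r) := by
  intro x y h
  rw [coordFunction_eq_sum, coordFunction_eq_sum] at h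
  have hk : ∀ k, dualCoeff x k = dualCoeff y k := by
    have := Fintype.linearIndependent_iff.1 hr (fun k => dualCoeff x k - dualCoeff y k)
      (by simp only [sub_smul, Finset.sum_sub_distrib, h, sub_self])
    exact fun k => sub_eq_zero.1 (this k)
  have key : ∀ k, (Fin.cons 0 x : Fin (n + 1) → ℚ) k = (Fin.cons 0 y : Fin (n + 1) → ℚ) k := by
    intro k
    induction k using Fin.induction with
    | zero => simp
    | succ k ih =>
      have := hk k.castSucc
      simp only [dualCoeff, Fin.snoc_castSucc] at this
      simp only [Fin.cons_succ]
      linarith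
  funext k
  simpa using key k.succ

/-- At `s`, the extensions `Fin.cons 0 x` and `Fin.snoc x 0` give the left and right neighbours of a
coordinate inserted at `s`, with `0` at the ends. -/
theorem snoc_insertNth_succAbove {n : ℕ} {α : Type*} (s : Fin (n + 1)) (a b : α) (x : Fin n → α)
    (k : Fin (n + 1)) :
    (Fin.snoc (s.insertNth a x : Fin (n + 1) → α) b : Fin (n + 2) → α) (s.castSucc.succAbove k) =
      (Fin.snoc x b : Fin (n + 1) → α) k := by
  induction k using Fin.lastCases with
  | last => simp
  | cast k => rw [Fin.castSucc_succAbove_castSucc]; simp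

theorem cons_insertNth_succAbove {n : ℕ} {α : Type*} (s : Fin (n + 1)) (a b : α) (x : Fin n → α)
    (k : Fin (n + 1)) :
    (Fin.cons b (s.insertNth a x : Fin (n + 1) → α) : Fin (n + 2) → α) (s.succ.succAbove k) =
      (Fin.cons b x : Fin (n + 1) → α) k := by
  induction k using Fin.cases with
  | zero => simp
  | succ k => rw [Fin.succ_succAbove_succ]; simp

theorem castSucc_succAbove_eq_ite {n : ℕ} (s k : Fin (n + 1)) :
    s.castSucc.succAbove k = if k = s then s.succ else s.succ.succAbove k := by
  simp only [Fin.succAbove, Fin.lt_def, Fin.ext_iff]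
  split_ifs <;> simp_all <;> omega

theorem castSucc_succAbove_eq_succ_iff {n : ℕ} (s k : Fin (n + 1)) :
    s.castSucc.succAbove k = s.succ ↔ k = s := by
  rw [← Fin.succAbove_castSucc_self s]
  exact Fin.succAbove_right_inj

/-- Interchanging `r^s` and `r^{s+1}` when a gap is closed up. -/
theorem coordFunction_succAbove_sub {n : ℕ} {B : Type*} [AddCommGroup B] [Module ℚ B]
    (r : Fin (n + 2) → Module.Dual ℚ B) (s : Fin (n + 1)) (x : Fin n → ℚ) :
    coordFunction (r ∘ s.castSucc.succAbove) x - coordFunction (r ∘ s.succ.succAbove) x =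
      dualCoeff x s • (r s.succ - r s.castSucc) := by
  rw [coordFunction_eq_sum, coordFunction_eq_sum, ← Finset.sum_sub_distrib,
    Finset.sum_eq_single s]
  · simp [smul_sub]
  · intro k _ hk
    simp [castSucc_succAbove_eq_ite, hk]
  · simp

/-- If the new coordinate equals its left neighbour, `r^s` drops out and the remaining coefficients
are those of `x`; any excess contributes a multiple of `r^s - r^{s+1}`. -/
theorem coordFunction_insertNth {n : ℕ} {B : Type*} [AddCommGroup B] [Module ℚ B]
    (r : Fin (n + 2) → Module.Dual ℚ B) (s : Fin (n + 1)) (a : ℚ) (x : Fin n → ℚ) :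
    coordFunction r (s.insertNth a x) = coordFunction (r ∘ s.castSucc.succAbove) x +
      (a - (Fin.cons 0 x : Fin (n + 1) → ℚ) s) • (r s.castSucc - r s.succ) := by
  have h1 : dualCoeff (s.insertNth a x : Fin (n + 1) → ℚ) s.castSucc =
      a - (Fin.cons 0 x : Fin (n + 1) → ℚ) s := by
    rw [dualCoeff, ← cons_insertNth_succAbove s a 0 x s, Fin.succAbove_succ_self]
    simp
  have h2 : ∀ k, dualCoeff (s.insertNth a x : Fin (n + 1) → ℚ) (s.castSucc.succAbove k) =
      dualCoeff x k - if k = s then a - (Fin.cons 0 x : Fin (n + 1) → ℚ) s else 0 := by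
    intro k
    rw [dualCoeff, snoc_insertNth_succAbove, castSucc_succAbove_eq_ite, dualCoeff]
    split_ifs with h
    · subst h; simp
    · rw [cons_insertNth_succAbove]; simp
  rw [coordFunction_eq_sum, coordFunction_eq_sum, Fin.sum_univ_succAbove _ s.castSucc, h1]
  simp only [h2, sub_smul, Finset.sum_sub_distrib, ite_smul, zero_smul, Finset.sum_ite_eq',
    Finset.mem_univ, if_true, Fin.succAbove_castSucc_self, Function.comp, smul_sub]
  abel

/-- With `dualCoeff_insertNth_succAbove_succ`, this carries the invariant on the coefficient at a
vertex's own label to the two copies in a fusion. -/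
theorem dualCoeff_insertNth_succAbove_castSucc {n : ℕ} (s : Fin (n + 1)) (x : Fin n → ℚ)
    (k : Fin (n + 1)) :
    dualCoeff (s.insertNth ((Fin.cons 0 x : Fin (n + 1) → ℚ) s) x : Fin (n + 1) → ℚ)
      (s.castSucc.succAbove k) = dualCoeff x k := by
  rw [dualCoeff, snoc_insertNth_succAbove, castSucc_succAbove_eq_ite, dualCoeff]
  split_ifs with h
  · subst h; simp
  · rw [cons_insertNth_succAbove]

theorem dualCoeff_insertNth_succAbove_succ {n : ℕ} (s : Fin (n + 1)) (d : ℚ) (x : Fin n → ℚ)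
    (k : Fin (n + 1)) :
    dualCoeff (s.insertNth ((Fin.snoc x 0 : Fin (n + 1) → ℚ) s + d) x : Fin (n + 1) → ℚ)
      (s.succ.succAbove k) = dualCoeff x k + if k = s then d else 0 := by
  rw [dualCoeff, cons_insertNth_succAbove, dualCoeff]
  split_ifs with h
  · subst h; simp; ring
  · have := snoc_insertNth_succAbove s ((Fin.snoc x 0 : Fin (n + 1) → ℚ) s + d) 0 x k
    rw [castSucc_succAbove_eq_ite, if_neg h] at this
    rw [this, add_zero]

/-! ### Pointed chains and uniqueness of the evaluation. -/

namespace LabelledGraph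

theorem fin_eq_zero_of_succ_eq {n : ℕ} {α : Type*} (f : Fin (n + 1) → α)
    (h : ∀ k : Fin n, f k.succ = f k.castSucc) (k : Fin (n + 1)) : f k = f 0 := by
  induction k using Fin.induction with
  | zero => rfl
  | succ k ih => rw [h, ih]

/-- The pointed chain of a binary fusion that corresponds to a pointed chain of the graph. -/
def fusionChain {n : ℕ} {G : LabelledGraph n} (s : Fin (n + 1)) (p : Fin (n + 1) → G.V)
    (k : Fin (n + 2)) : G.V ⊕ G.V :=
  if s.castSucc < k then .inl (p (s.predAbove k)) else .inr (p (s.predAbove k))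

theorem val_predAbove {n : ℕ} (s : Fin n) (k : Fin (n + 1)) :
    (s.predAbove k : ℕ) = if (s : ℕ) < k then (k : ℕ) - 1 else k := by
  unfold Fin.predAbove
  simp only [Fin.lt_def, Fin.val_castSucc]
  split_ifs <;> rfl

theorem val_succAbove {n : ℕ} (s : Fin (n + 1)) (q : Fin n) :
    (s.succAbove q : ℕ) = if (q : ℕ) < s then (q : ℕ) else q + 1 := by
  unfold Fin.succAbove
  simp only [Fin.lt_def, Fin.val_castSucc]
  split_ifs <;> rfl

theorem predAbove_succ_succAbove {n : ℕ} (s : Fin (n + 1)) (q : Fin n) :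
    s.predAbove (s.succAbove q).succ = q.succ := by
  simp only [Fin.ext_iff, val_predAbove, val_succAbove, Fin.val_succ]
  split_ifs <;> omega

theorem predAbove_castSucc_succAbove {n : ℕ} (s : Fin (n + 1)) (q : Fin n) :
    s.predAbove (s.succAbove q).castSucc = q.castSucc := by
  simp only [Fin.ext_iff, val_predAbove, val_succAbove, Fin.val_castSucc]
  split_ifs <;> omega

/-- An edge of the chain whose label is not `s` does not cross the threshold at which the chain
changes copies. -/
theorem castSucc_lt_succ_succAbove_iff {n : ℕ} (s : Fin (n + 1)) (q : Fin n) :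
    s.castSucc < (s.succAbove q).succ ↔ s.castSucc < (s.succAbove q).castSucc := by
  have := Fin.val_ne_of_ne (Fin.succAbove_ne s q)
  simp only [Fin.lt_def, Fin.val_succ, Fin.val_castSucc]
  omega

theorem castSucc_succAbove_predAbove {n : ℕ} (s : Fin (n + 1)) (k : Fin (n + 2))
    (h : s.castSucc < k) : s.castSucc.succAbove (s.predAbove k) = k := by
  simp only [Fin.ext_iff, val_predAbove, val_succAbove, Fin.lt_def,
    Fin.val_castSucc] at *
  split_ifs <;> omega

theorem succ_succAbove_predAbove {n : ℕ} (s : Fin (n + 1)) (k : Fin (n + 2))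
    (h : ¬ s.castSucc < k) : s.succ.succAbove (s.predAbove k) = k := by
  simp only [Fin.ext_iff, val_predAbove, val_succAbove, Fin.lt_def,
    Fin.val_succ, Fin.val_castSucc] at *
  split_ifs <;> omega

theorem IsPointedChain.fusionChain {n : ℕ} {G : LabelledGraph n} (s : Fin (n + 1))
    {p : Fin (n + 1) → G.V} (hp : G.IsPointedChain p) :
    (G.fusion s).IsPointedChain (fusionChain s p) := by
  refine ⟨fun k => ?_, fun k => ?_⟩
  · unfold LabelledGraph.fusionChain
    split_ifs with h
    · simpa [fusion, hp.1] using castSucc_succAbove_predAbove s k h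
    · simpa [fusion, hp.1] using succ_succAbove_predAbove s k h
  · change G.fusionAdj s k (LabelledGraph.fusionChain s p k.succ)
      (LabelledGraph.fusionChain s p k.castSucc)
    rcases Fin.eq_self_or_eq_succAbove s k with rfl | ⟨q, rfl⟩
    · simp [LabelledGraph.fusionChain, fusionAdj, hp.1]
    · unfold LabelledGraph.fusionChain
      simp only [predAbove_succ_succAbove, predAbove_castSucc_succAbove,
        castSucc_lt_succ_succAbove_iff]
      split_ifs <;> exact ⟨q, rfl, hp.2 q⟩

/-- Only edges labelled `s` join the copies, and `𝒢⁺` has no label `s`. Hence the chain changes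
copies exactly once, from `v_{s+1}` in `𝒢⁺` to the same vertex `v_s` in `𝒢⁻`; merging these two
gives a chain of `G`. -/
theorem IsPointedChain.exists_eq_fusionChain {n : ℕ} {G : LabelledGraph n} {s : Fin (n + 1)}
    {p : Fin (n + 2) → G.V ⊕ G.V} (hp : (G.fusion s).IsPointedChain p) :
    ∃ p', G.IsPointedChain p' ∧ p = LabelledGraph.fusionChain s p' := by
  have hadj : ∀ k, G.fusionAdj s k (p k.succ) (p k.castSucc) := hp.2
  have hlab : ∀ k, Sum.elim (fun v => s.castSucc.succAbove (G.label v))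
    (fun v => s.succ.succAbove (G.label v)) (p k) = k := hp.1
  have hs : ∃ v, p s.succ = .inl v ∧ p s.castSucc = .inr v := by
    have h := hadj s
    have hl := hlab s.castSucc
    rcases h1 : p s.succ with v | v <;> rcases h2 : p s.castSucc with w | w <;>
      rw [h1, h2] at h <;> rw [h2] at hl
    · obtain ⟨q, hq, -⟩ := h
      exact absurd hq (Fin.succAbove_ne s q)
    · obtain ⟨-, rfl, -⟩ := h
      exact ⟨v, rfl, rfl⟩
    · exact absurd hl (Fin.succAbove_ne _ _)
    · obtain ⟨q, hq, -⟩ := h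
      exact absurd hq (Fin.succAbove_ne s q)
  obtain ⟨v₀, hv₁, hv₂⟩ := hs
  have hside : ∀ k, (p k).isLeft = decide (s.castSucc < k) := by
    -- The side and the comparison with `s` flip together, at the edge labelled `s` only, so their
    -- exclusive or is constant along the chain.
    have hconst : ∀ k, ((p k).isLeft ^^ decide (s.castSucc < k)) =
        ((p 0).isLeft ^^ decide (s.castSucc < 0)) := by
      refine fin_eq_zero_of_succ_eq (fun k => ((p k).isLeft ^^ decide (s.castSucc < k))) ?_
      intro k
      rcases Fin.eq_self_or_eq_succAbove s k with rfl | ⟨q, rfl⟩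
      · simp [hv₁, hv₂]
      · have h := hadj (s.succAbove q)
        simp only [castSucc_lt_succ_succAbove_iff]
        rcases h1 : p (s.succAbove q).succ with v | v <;>
          rcases h2 : p (s.succAbove q).castSucc with w | w <;> rw [h1, h2] at h
        · simp
        · exact absurd h.1 (Fin.succAbove_ne s q)
        · exact absurd h.1 (Fin.succAbove_ne s q)
        · simp
    intro k
    have h := (hconst k).trans (hconst s.castSucc).symm
    simpa [hv₂] using h
  set u : G.V ⊕ G.V → G.V := Sum.elim id id with hu
  set p' : Fin (n + 1) → G.V := fun k => u (p (s.castSucc.succAbove k)) with hp'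
  have hup : ∀ k, u (p k) = p' (s.predAbove k) := by
    intro k
    by_cases h : k = s.castSucc
    · subst h
      simp [hp', hv₁, hv₂, hu]
    · obtain ⟨q, rfl⟩ := Fin.exists_succAbove_eq h
      simp [hp']
  have hpp : p = LabelledGraph.fusionChain s p' := by
    funext k
    have h := hside k
    have h' := hup k
    unfold LabelledGraph.fusionChain
    rcases h1 : p k with v | v <;> rw [h1] at h h' <;> simp at h <;> simp [← h', h, hu]
  refine ⟨p', ⟨fun k => ?_, fun q => ?_⟩, hpp⟩
  · have h := hlab (s.castSucc.succAbove k)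
    rw [hpp, LabelledGraph.fusionChain] at h
    simp only [Fin.predAbove_succAbove] at h
    split_ifs at h with hlt
    · exact Fin.succAbove_right_injective h
    · rw [castSucc_succAbove_eq_ite, if_neg] at h
      · exact Fin.succAbove_right_injective h
      · rintro rfl
        simp at hlt
  · have h := hadj (s.succAbove q)
    rw [hpp] at h
    simp only [LabelledGraph.fusionChain, predAbove_succ_succAbove, predAbove_castSucc_succAbove,
      castSucc_lt_succ_succAbove_iff] at h
    split_ifs at h <;> obtain ⟨q', hq, h⟩ := h <;>
      rwa [Fin.succAbove_right_injective hq] at h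

theorem fusionChain_injective {n : ℕ} {G : LabelledGraph n} (s : Fin (n + 1)) :
    Function.Injective (fusionChain (G := G) s) := by
  intro p p' h
  funext k
  have h := congrFun h (s.castSucc.succAbove k)
  simp only [fusionChain, Fin.predAbove_succAbove] at h
  split_ifs at h
  · exact Sum.inl_injective h
  · exact Sum.inr_injective h

theorem existsUnique_isPointedChain : ∀ (n : ℕ) (prec : Fin n → Fin n → Prop),
    ∃! p, (canonicalGraph n prec).IsPointedChain p
  | 0, _ => ⟨fun _ => (), ⟨fun k => Subsingleton.elim (α := Fin 1) _ _, fun k => k.elim0⟩,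
      fun _ _ => rfl⟩
  | n + 1, prec => by
    obtain ⟨p, hp, hu⟩ := existsUnique_isPointedChain n fun i j =>
      prec ((largest prec).succAbove i) ((largest prec).succAbove j)
    refine ⟨fusionChain (largest prec) p, hp.fusionChain _, fun q hq => ?_⟩
    obtain ⟨p', hp', h⟩ := IsPointedChain.exists_eq_fusionChain hq
    rw [h, hu p' hp']

/-- The canonical `S`-graph is connected. -/
theorem eq_of_forall_adj_eq {α : Type*} : ∀ (n : ℕ) (prec : Fin n → Fin n → Prop)
    (f : (canonicalGraph n prec).V → α)
    (_ : ∀ k v w, ((canonicalGraph n prec).edge k).Adj v w → f v = f w)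
    (v w : (canonicalGraph n prec).V), f v = f w
  | 0, _, _, _, _, _ => rfl
  | n + 1, prec, f, hf, v, w => by
    set s := largest prec
    have hl : ∀ v w, f (.inl v) = f (.inl w) := eq_of_forall_adj_eq n _ (fun v => f (.inl v))
      fun k v w h => hf (s.succAbove k) (.inl v) (.inl w) ⟨k, rfl, h⟩
    have hr : ∀ v w, f (.inr v) = f (.inr w) := eq_of_forall_adj_eq n _ (fun v => f (.inr v))
      fun k v w h => hf (s.succAbove k) (.inr v) (.inr w) ⟨k, rfl, h⟩
    -- The pointed chain provides a vertex with label `s`, hence an edge joining the two copies.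
    obtain ⟨p, hp, -⟩ := existsUnique_isPointedChain n fun i j =>
      prec (s.succAbove i) (s.succAbove j)
    have hs : f (.inl (p s)) = f (.inr (p s)) := hf s (.inl (p s)) (.inr (p s))
      ⟨rfl, rfl, (castSucc_succAbove_eq_succ_iff _ _).2 (hp.1 s)⟩
    have hlr : ∀ v w, f (.inl v) = f (.inr w) := fun v w => (hl v _).trans (hs.trans (hr _ w))
    rcases v with v | v <;> rcases w with w | w
    · exact hl v w
    · exact hlr v w
    · exact (hlr w v).symm
    · exact hr v w

/-- The difference of two evaluations is constant along edges, hence constant, and it vanishes at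
the vertex of label `n+1` of the pointed chain. -/
theorem IsEvaluation.eq {n : ℕ} {B : Type*} [AddCommGroup B] [Module ℚ B] {c : Fin n → ℕ}
    {prec : Fin n → Fin n → Prop} {r : Fin (n + 1) → Module.Dual ℚ B}
    {z z' : (canonicalGraph n prec).V → Module.Dual ℚ B}
    (hz : (canonicalGraph n prec).IsEvaluation c r z)
    (hz' : (canonicalGraph n prec).IsEvaluation c r z') : z = z' := by
  obtain ⟨p, hp, -⟩ := existsUnique_isPointedChain n prec
  funext v
  have h := eq_of_forall_adj_eq n prec (fun v => z v - z' v) (fun k v w h => by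
    have h1 := hz.1 k v w h
    rw [← hz'.1 k v w h] at h1
    exact sub_eq_sub_iff_sub_eq_sub.1 h1) v (p (Fin.last n))
  simp only [hz.2 p hp, hz'.2 p hp, sub_self] at h
  exact sub_eq_zero.1 h

end LabelledGraph

/-! ### Extreme points of a region between two graphs. -/

/-- The extreme points of the region between the graphs of two affine functions `L ≤ U` over `K`. -/
theorem extremePoints_setOf_between {n : ℕ} (K : Set (Fin n → ℚ)) (s : Fin (n + 1))
    (L U : (Fin n → ℚ) → ℚ)
    (hL : ∀ a b x y, a + b = 1 → L (a • x + b • y) = a * L x + b * L y)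
    (hU : ∀ a b x y, a + b = 1 → U (a • x + b • y) = a * U x + b * U y)
    (hLU : ∀ x ∈ K, L x ≤ U x) :
    Set.extremePoints ℚ {y : Fin (n + 1) → ℚ | s.removeNth y ∈ K ∧
      L (s.removeNth y) ≤ y s ∧ y s ≤ U (s.removeNth y)} =
    (fun x => (s.insertNth (L x) x : Fin (n + 1) → ℚ)) '' Set.extremePoints ℚ K ∪
    (fun x => (s.insertNth (U x) x : Fin (n + 1) → ℚ)) '' Set.extremePoints ℚ K := by
  have hins : ∀ (a b t₁ t₂ : ℚ) (x₁ x₂ : Fin n → ℚ),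
      a • (s.insertNth t₁ x₁ : Fin (n + 1) → ℚ) + b • (s.insertNth t₂ x₂ : Fin (n + 1) → ℚ) =
        s.insertNth (a * t₁ + b * t₂) (a • x₁ + b • x₂) := by
    intro a b t₁ t₂ x₁ x₂
    funext k
    rcases Fin.eq_self_or_eq_succAbove s k with rfl | ⟨q, rfl⟩ <;> simp
  have hrem : ∀ (a b : ℚ) (y₁ y₂ : Fin (n + 1) → ℚ),
      s.removeNth (a • y₁ + b • y₂) = a • s.removeNth y₁ + b • s.removeNth y₂ :=
    fun _ _ _ _ => rfl
  ext y
  constructor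
  · intro hy
    obtain ⟨⟨hyK, hyL, hyU⟩, hext⟩ := mem_extremePoints_iff_left.1 hy
    obtain ⟨t, x, rfl⟩ : ∃ t x, y = s.insertNth t x :=
      ⟨y s, s.removeNth y, (Fin.insertNth_self_removeNth s y).symm⟩
    simp only [Fin.removeNth_insertNth, Fin.insertNth_apply_same] at hyK hyL hyU
    have hxext : x ∈ Set.extremePoints ℚ K := by
      refine mem_extremePoints_iff_left.2 ⟨hyK, ?_⟩
      rintro x₁ h₁ x₂ h₂ ⟨a, b, ha, hb, hab, rfl⟩
      -- The section at fixed relative height `u` between `L` and `U` is affine, so it lifts a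
      -- segment through the base point to one through `y`. The choice `u = 0` covers `L = U`.
      obtain ⟨u, hu0, hu1, hu⟩ : ∃ u : ℚ, 0 ≤ u ∧ u ≤ 1 ∧
          t = (1 - u) * L (a • x₁ + b • x₂) + u * U (a • x₁ + b • x₂) := by
        rcases hyL.eq_or_lt with h | h
        · exact ⟨0, le_rfl, zero_le_one, by rw [← h]; ring⟩
        · have hpos : 0 < U (a • x₁ + b • x₂) - L (a • x₁ + b • x₂) := by linarith
          refine ⟨(t - L (a • x₁ + b • x₂)) / (U (a • x₁ + b • x₂) - L (a • x₁ + b • x₂)),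
            div_nonneg (by linarith) hpos.le, (div_le_one hpos).2 (by linarith), ?_⟩
          field_simp
          ring
      have hmem : ∀ x ∈ K, (s.insertNth ((1 - u) * L x + u * U x) x : Fin (n + 1) → ℚ) ∈
          {y : Fin (n + 1) → ℚ | s.removeNth y ∈ K ∧
            L (s.removeNth y) ≤ y s ∧ y s ≤ U (s.removeNth y)} := by
        intro x hx
        have := hLU x hx
        simp only [Set.mem_ofPred_eq, Fin.removeNth_insertNth, Fin.insertNth_apply_same]
        exact ⟨hx, by nlinarith, by nlinarith⟩
      have h := hext _ (hmem x₁ h₁) _ (hmem x₂ h₂) ⟨a, b, ha, hb, hab, by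
        rw [hins, hu, hL _ _ _ _ hab, hU _ _ _ _ hab]
        congr 1
        ring⟩
      simpa using congrArg s.removeNth h
    by_cases h1 : t = L x
    · exact .inl ⟨x, hxext, by rw [h1]⟩
    by_cases h2 : t = U x
    · exact .inr ⟨x, hxext, by rw [h2]⟩
    -- Otherwise `y` is interior to the vertical segment over `x`.
    exfalso
    have hlt : L x < t := lt_of_le_of_ne hyL (Ne.symm h1)
    have hgt : t < U x := lt_of_le_of_ne hyU h2
    have hpos : 0 < U x - L x := by linarith
    have h := hext (s.insertNth (L x) x)
      (by simpa using ⟨hyK, hLU x hyK⟩) (s.insertNth (U x) x) (by simpa using ⟨hyK, hLU x hyK⟩)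
      ⟨(U x - t) / (U x - L x), (t - L x) / (U x - L x), div_pos (by linarith) hpos,
        div_pos (by linarith) hpos, by field_simp; ring, by
        rw [hins, ← add_smul]
        congr 1
        · field_simp
          ring
        · rw [← add_div, show U x - t + (t - L x) = U x - L x by ring, div_self hpos.ne',
            one_smul]⟩
    have := congrFun h s
    simp only [Fin.insertNth_apply_same] at this
    exact h1 this.symm
  · have aux : ∀ x ∈ Set.extremePoints ℚ K, ∀ t, L x ≤ t → t ≤ U x → (t = L x ∨ t = U x) →
        (s.insertNth t x : Fin (n + 1) → ℚ) ∈ Set.extremePoints ℚ {y : Fin (n + 1) → ℚ |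
          s.removeNth y ∈ K ∧ L (s.removeNth y) ≤ y s ∧ y s ≤ U (s.removeNth y)} := by
      intro x hx t ht1 ht2 ht
      obtain ⟨hxK, hext⟩ := mem_extremePoints.1 hx
      refine mem_extremePoints_iff_left.2 ⟨by simpa using ⟨hxK, ht1, ht2⟩, ?_⟩
      rintro y₁ ⟨h₁, h₁L, h₁U⟩ y₂ ⟨h₂, h₂L, h₂U⟩ ⟨a, b, ha, hb, hab, h⟩
      have hx' := congrArg s.removeNth h
      rw [hrem, Fin.removeNth_insertNth] at hx'
      obtain ⟨e₁, e₂⟩ := hext _ h₁ _ h₂ ⟨a, b, ha, hb, hab, hx'⟩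
      have hs := congrFun h s
      simp only [Pi.add_apply, Pi.smul_apply, smul_eq_mul, Fin.insertNth_apply_same] at hs
      rw [e₁] at h₁L h₁U
      rw [e₂] at h₂L h₂U
      -- Both points now lie over `x`, and `t` is an end of the vertical interval, so a proper
      -- convex combination can equal `t` only trivially.
      have hy : y₁ s = t := by
        obtain rfl : b = 1 - a := by linarith
        rcases ht with ht | ht <;> apply le_antisymm <;> nlinarith
      rw [← Fin.insertNth_self_removeNth s y₁, e₁, hy]
    rintro (⟨x, hx, rfl⟩ | ⟨x, hx, rfl⟩)
    · exact aux x hx _ le_rfl (hLU x hx.1) (.inl rfl)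
    · exact aux x hx _ (hLU x hx.1) le_rfl (.inr rfl)

/-! ### The polytope as a region over the smaller polytope. -/

theorem nearestNeighbours_succAbove_iff {n : ℕ} {s : Fin (n + 1)} {S : Set (Fin (n + 1))}
    (hs : s ∉ S) {i j : Fin (n + 1)} : NearestNeighbours S i j ↔
      ∃ i' j', s.succAbove i' = i ∧ s.succAbove j' = j ∧
        NearestNeighbours (s.succAbove ⁻¹' S) i' j' := by
  constructor
  · rintro ⟨hi, hj, hij, h⟩
    obtain ⟨i', rfl⟩ := Fin.exists_succAbove_eq (ne_of_mem_of_not_mem hi hs)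
    obtain ⟨j', rfl⟩ := Fin.exists_succAbove_eq (ne_of_mem_of_not_mem hj hs)
    refine ⟨i', j', rfl, rfl, hi, hj, Fin.succAbove_lt_succAbove_iff.1 hij, fun l hl hlt => ?_⟩
    exact h _ hl ⟨Fin.succAbove_lt_succAbove_iff.2 hlt.1, Fin.succAbove_lt_succAbove_iff.2 hlt.2⟩
  · rintro ⟨i', j', rfl, rfl, hi, hj, hij, h⟩
    refine ⟨hi, hj, Fin.succAbove_lt_succAbove_iff.2 hij, fun l hl hlt => ?_⟩
    obtain ⟨l', rfl⟩ := Fin.exists_succAbove_eq (ne_of_mem_of_not_mem hl hs)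
    exact h l' hl
      ⟨Fin.succAbove_lt_succAbove_iff.1 hlt.1, Fin.succAbove_lt_succAbove_iff.1 hlt.2⟩

theorem initialSegment_largest {n : ℕ} (prec : Fin (n + 1) → Fin (n + 1) → Prop)
    [IsStrictTotalOrder (Fin (n + 1)) prec] : initialSegment prec (largest prec) = Set.univ := by
  ext j
  simp only [initialSegment, Set.mem_ofPred_eq, Set.mem_univ, iff_true]
  exact (em (j = largest prec)).symm.imp_left (largest_spec prec j)

theorem largest_notMem_initialSegment {n : ℕ} (prec : Fin (n + 1) → Fin (n + 1) → Prop)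
    [IsStrictTotalOrder (Fin (n + 1)) prec] (m : Fin n) :
    largest prec ∉ initialSegment prec ((largest prec).succAbove m) := by
  have hne := Fin.succAbove_ne (largest prec) m
  rintro (h | h)
  · exact irrefl_of prec _ (trans_of prec h (largest_spec prec _ hne))
  · exact hne h.symm

theorem preimage_initialSegment_succAbove {n : ℕ} (prec : Fin (n + 1) → Fin (n + 1) → Prop)
    (s : Fin (n + 1)) (m : Fin n) :
    s.succAbove ⁻¹' initialSegment prec (s.succAbove m) =
      initialSegment (fun i j => prec (s.succAbove i) (s.succAbove j)) m := by
  ext j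
  simp [initialSegment]

/-- The initial segment ending at the largest index is everything, so consecutive indices are always
constrained. -/
theorem min_le_sub_of_mem_KSet {n : ℕ} {c : Fin n → ℕ} {prec : Fin n → Fin n → Prop}
    [IsStrictTotalOrder (Fin n) prec] {x : Fin n → ℚ} (hx : x ∈ KSet c prec) {i j : Fin n}
    (hij : NearestNeighbours Set.univ i j) : min 0 ((c j : ℚ) - c i) ≤ x j - x i := by
  cases n with
  | zero => exact i.elim0
  | succ n => exact hx.2 (largest prec) i j (by rwa [initialSegment_largest])

theorem nearestNeighbours_univ_iff {n : ℕ} {i j : Fin n} :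
    NearestNeighbours Set.univ i j ↔ (j : ℕ) = i + 1 := by
  simp only [NearestNeighbours, Set.mem_univ, true_and, forall_const, not_and, not_lt,
    Fin.lt_def]
  constructor
  · rintro ⟨h1, h2⟩
    have := h2 ⟨i + 1, by omega⟩
    simp at this
    omega
  · intro h
    exact ⟨by omega, fun l hl => by omega⟩

instance isStrictTotalOrder_succAbove {n : ℕ} (prec : Fin (n + 1) → Fin (n + 1) → Prop)
    [IsStrictTotalOrder (Fin (n + 1)) prec] (s : Fin (n + 1)) :
    IsStrictTotalOrder (Fin n) fun i j => prec (s.succAbove i) (s.succAbove j) :=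
  Fin.succAbove_right_injective.isStrictTotalOrder_onFun (r := prec)

/-- The lower bound that the inequalities of the polytope impose on the coordinate of the largest
index `s` does not exceed the upper bound. -/
theorem cons_le_snoc_of_mem_KSet {n : ℕ} {c : Fin (n + 1) → ℕ} {s : Fin (n + 1)}
    {prec : Fin n → Fin n → Prop} [IsStrictTotalOrder (Fin n) prec] (hs : ∀ j, c j ≤ c s)
    {x : Fin n → ℚ} (hx : x ∈ KSet (fun i => c (s.succAbove i)) prec) :
    (Fin.cons 0 x : Fin (n + 1) → ℚ) s ≤ (Fin.snoc x 0 : Fin (n + 1) → ℚ) s +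
      (c s - (Fin.snoc (fun i => (c (s.succAbove i) : ℚ)) 0 : Fin (n + 1) → ℚ) s) := by
  have hcs : ∀ j, (c j : ℚ) ≤ c s := fun j => by exact_mod_cast hs j
  have h0 : (0 : ℚ) ≤ c s := by positivity
  have hb := hx.1
  induction s using Fin.cases with
  | zero =>
    cases n with
    | zero => simp [Fin.snoc]
    | succ n =>
      rw [← Fin.castSucc_zero, Fin.snoc_castSucc, Fin.snoc_castSucc, Fin.castSucc_zero,
        Fin.cons_zero]
      linarith [(hb 0).1, hcs (Fin.succAbove 0 0)]
  | succ i =>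
    rw [Fin.cons_succ]
    obtain h | ⟨j, hj⟩ := Fin.eq_castSucc_or_eq_last i.succ |>.symm
    · rw [h, Fin.snoc_last, Fin.snoc_last, ← h]
      linarith [(hb i).2, hcs (i.succ.succAbove i)]
    · have h := min_le_sub_of_mem_KSet hx (i := i) (j := j)
        (nearestNeighbours_univ_iff.2 (by simpa using (congrArg Fin.val hj).symm))
      rw [hj, Fin.snoc_castSucc, Fin.snoc_castSucc, ← hj]
      -- Maximality of `c s` is used against its right neighbour if the minimum is `0`, against its
      -- left neighbour otherwise.
      have h1 := hcs (i.succ.succAbove i)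
      have h2 := hcs (i.succ.succAbove j)
      rcases min_le_iff.1 h with h | h <;> linarith

/-- The recursive description of the polytope. -/
theorem mem_KSet_iff {n : ℕ} {c : Fin (n + 1) → ℕ} {prec : Fin (n + 1) → Fin (n + 1) → Prop}
    [IsStrictTotalOrder (Fin (n + 1)) prec] (hc : ∀ i j, prec i j → c i ≤ c j)
    {s : Fin (n + 1)} (hs : s = largest prec) {y : Fin (n + 1) → ℚ} :
    y ∈ KSet c prec ↔ s.removeNth y ∈ KSet (fun i => c (s.succAbove i))
        (fun i j => prec (s.succAbove i) (s.succAbove j)) ∧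
      (Fin.cons 0 (s.removeNth y) : Fin (n + 1) → ℚ) s ≤ y s ∧
      y s ≤ (Fin.snoc (s.removeNth y) 0 : Fin (n + 1) → ℚ) s +
        (c s - (Fin.snoc (fun i => (c (s.succAbove i) : ℚ)) 0 : Fin (n + 1) → ℚ) s) := by
  have hmax : ∀ j, c j ≤ c s := fun j => by
    by_cases h : j = s
    · rw [h]
    · subst hs
      exact hc _ _ (largest_spec prec j h)
  have hcs : ∀ j, (c j : ℚ) ≤ c s := fun j => by exact_mod_cast hmax j
  constructor
  · intro hy
    have hb := hy.1
    refine ⟨⟨fun k => hb _, fun m i j hij => ?_⟩, ?_, ?_⟩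
    · subst hs
      refine hy.2 ((largest prec).succAbove m) _ _ ((nearestNeighbours_succAbove_iff
        (largest_notMem_initialSegment prec m)).2 ⟨i, j, rfl, rfl, ?_⟩)
      rwa [preimage_initialSegment_succAbove]
    · clear hs
      induction s using Fin.cases with
      | zero => exact (hb 0).1
      | succ i =>
        have h := min_le_sub_of_mem_KSet hy (i := i.castSucc) (j := i.succ)
          (nearestNeighbours_univ_iff.2 (by simp))
        -- Maximality of `c s` decides the minimum, here and for the right neighbour below; this
        -- makes the bounds affine.
        rw [min_eq_left (by linarith [hcs i.castSucc])] at h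
        rw [Fin.cons_succ, Fin.removeNth, Fin.succAbove_succ_self]
        linarith
    · clear hs
      induction s using Fin.lastCases with
      | last => simpa using (hb (Fin.last n)).2
      | cast i =>
        have h := min_le_sub_of_mem_KSet hy (i := i.castSucc) (j := i.succ)
          (nearestNeighbours_univ_iff.2 (by simp))
        rw [min_eq_right (by linarith [hcs i.succ])] at h
        rw [Fin.snoc_castSucc, Fin.snoc_castSucc, Fin.removeNth, Fin.succAbove_castSucc_self]
        linarith
  · rintro ⟨hx, hl, hu⟩
    have hb : ∀ k, 0 ≤ y (s.succAbove k) ∧ y (s.succAbove k) ≤ c (s.succAbove k) := hx.1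
    -- The bounds `0 ≤ y s ≤ c s` are inherited from the neighbours through `hl0` and `hu0`.
    have hl0 : (0 : ℚ) ≤ (Fin.cons 0 (s.removeNth y) : Fin (n + 1) → ℚ) s := by
      clear hs hl hu hmax hcs hx
      induction s using Fin.cases with
      | zero => simp
      | succ i => simpa [Fin.removeNth] using (hb i).1
    have hu0 : (Fin.snoc (s.removeNth y) 0 : Fin (n + 1) → ℚ) s ≤
        (Fin.snoc (fun i => (c (s.succAbove i) : ℚ)) 0 : Fin (n + 1) → ℚ) s := by
      clear hs hl hu hmax hcs hx hl0
      induction s using Fin.lastCases with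
      | last => simp
      | cast i => simpa [Fin.removeNth] using (hb i).2
    refine ⟨fun k => ?_, fun m i j hij => ?_⟩
    · rcases Fin.eq_self_or_eq_succAbove s k with rfl | ⟨q, rfl⟩
      · exact ⟨hl0.trans hl, by linarith⟩
      · exact hb q
    · rcases Fin.eq_self_or_eq_succAbove s m with rfl | ⟨m, rfl⟩
      · rw [hs, initialSegment_largest, nearestNeighbours_univ_iff] at hij
        clear hs
        by_cases hi : i = m
        · subst hi
          obtain ⟨k, rfl⟩ : ∃ k : Fin n, i = k.castSucc :=
            ⟨⟨i, by omega⟩, rfl⟩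
          obtain rfl : j = k.succ := Fin.ext (by simpa using hij)
          rw [Fin.snoc_castSucc, Fin.snoc_castSucc, Fin.removeNth,
            Fin.succAbove_castSucc_self] at hu
          exact (min_le_right _ _).trans (by linarith)
        by_cases hj : j = m
        · subst hj
          obtain ⟨k, rfl⟩ : ∃ k : Fin n, j = k.succ :=
            ⟨⟨i, by omega⟩, Fin.ext (by simpa using hij)⟩
          obtain rfl : i = k.castSucc := Fin.ext (by simpa using hij.symm)
          rw [Fin.cons_succ, Fin.removeNth, Fin.succAbove_succ_self] at hl
          exact (min_le_left _ _).trans (by linarith)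
        · obtain ⟨i, rfl⟩ := Fin.exists_succAbove_eq hi
          obtain ⟨j, rfl⟩ := Fin.exists_succAbove_eq hj
          -- A consecutive pair avoiding the removed index stays consecutive when the gap is closed.
          refine min_le_sub_of_mem_KSet hx (nearestNeighbours_univ_iff.2 ?_)
          have h1 : i < j := (Fin.succAbove_lt_succAbove_iff (p := m)).1
            (Fin.lt_def.2 (by omega))
          have h2 : ∀ l : Fin n, ¬ (i < l ∧ l < j) := fun l hlt => by
            have h3 := Fin.lt_def.1 ((Fin.succAbove_lt_succAbove_iff (p := m)).2 hlt.1)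
            have h4 := Fin.lt_def.1 ((Fin.succAbove_lt_succAbove_iff (p := m)).2 hlt.2)
            omega
          exact nearestNeighbours_univ_iff.1 ⟨trivial, trivial, h1, fun l _ => h2 l⟩
      · subst hs
        obtain ⟨i, j, rfl, rfl, h⟩ :=
          (nearestNeighbours_succAbove_iff (largest_notMem_initialSegment prec m)).1 hij
        rw [preimage_initialSegment_succAbove] at h
        exact hx.2 m i j h

theorem extremePoints_KSet {n : ℕ} {c : Fin (n + 1) → ℕ}
    {prec : Fin (n + 1) → Fin (n + 1) → Prop} [IsStrictTotalOrder (Fin (n + 1)) prec]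
    (hc : ∀ i j, prec i j → c i ≤ c j) {s : Fin (n + 1)} (hs : s = largest prec) :
    Set.extremePoints ℚ (KSet c prec) =
      (fun x => (s.insertNth ((Fin.cons 0 x : Fin (n + 1) → ℚ) s) x : Fin (n + 1) → ℚ)) ''
        Set.extremePoints ℚ (KSet (fun i => c (s.succAbove i))
          (fun i j => prec (s.succAbove i) (s.succAbove j))) ∪
      (fun x => (s.insertNth ((Fin.snoc x 0 : Fin (n + 1) → ℚ) s +
        (c s - (Fin.snoc (fun i => (c (s.succAbove i) : ℚ)) 0 : Fin (n + 1) → ℚ) s)) x :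
          Fin (n + 1) → ℚ)) ''
        Set.extremePoints ℚ (KSet (fun i => c (s.succAbove i))
          (fun i j => prec (s.succAbove i) (s.succAbove j))) := by
  rw [← extremePoints_setOf_between]
  · congr 1
    ext y
    exact mem_KSet_iff hc hs
  · intro a b x y _
    clear hs
    induction s using Fin.cases <;> simp
  · intro a b x y hab
    have h : (Fin.snoc (a • x + b • y) 0 : Fin (n + 1) → ℚ) s =
        a * (Fin.snoc x 0 : Fin (n + 1) → ℚ) s + b * (Fin.snoc y 0 : Fin (n + 1) → ℚ) s := by
      clear hs
      induction s using Fin.lastCases <;> simp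
    obtain rfl : b = 1 - a := by linarith
    rw [h]
    ring
  · refine fun x hx => cons_le_snoc_of_mem_KSet (fun j => ?_) hx
    by_cases h : j = s
    · rw [h]
    · subst hs
      exact hc _ _ (largest_spec prec j h)

/-! ### The evaluation in coordinates and the main theorem. -/

/-- The evaluation of the canonical `S`-graph in coordinates: its values are the extreme points of
the polytope, and the vertex labels can be read off from the coefficients. -/
theorem exists_coordinates_isEvaluation {B : Type*} [AddCommGroup B] [Module ℚ B] :
    ∀ (n : ℕ) (c : Fin n → ℕ) (prec : Fin n → Fin n → Prop) [IsStrictTotalOrder (Fin n) prec]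
      (_ : ∀ i j, prec i j → c i ≤ c j),
    ∃ x : (canonicalGraph n prec).V → Fin n → ℚ,
      (∀ r : Fin (n + 1) → Module.Dual ℚ B,
        (canonicalGraph n prec).IsEvaluation c r fun v => coordFunction r (x v)) ∧
      (∀ p, (canonicalGraph n prec).IsPointedChain p → x (p (Fin.last n)) = 0) ∧
      (∀ v, dualCoeff (x v) ((canonicalGraph n prec).label v) =
        (Fin.snoc (fun i => (c i : ℚ)) 0 : Fin (n + 1) → ℚ) ((canonicalGraph n prec).label v)) ∧
      Set.range x = Set.extremePoints ℚ (KSet c prec)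
  | 0, c, prec, _, _ => by
    refine ⟨fun _ => 0, fun r => ⟨fun k => k.elim0, fun _ _ => by simp [coordFunction]⟩,
      fun _ _ => rfl, fun v => ?_, ?_⟩
    · have h : (canonicalGraph 0 prec).label v = Fin.last 0 := Subsingleton.elim (α := Fin 1) _ _
      rw [h]
      simp [dualCoeff, Fin.snoc]
    · have hK : KSet c prec = {0} := by
        ext y
        simp only [Set.mem_singleton_iff, Subsingleton.elim y 0, iff_true]
        exact ⟨fun k => k.elim0, fun m => m.elim0⟩
      rw [hK, extremePoints_singleton]
      ext y
      exact ⟨fun _ => Subsingleton.elim _ _, fun _ => ⟨(), Subsingleton.elim _ _⟩⟩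
  | n + 1, c, prec, _, hc => by
    obtain ⟨s, hs⟩ : ∃ s, s = largest prec := ⟨_, rfl⟩
    obtain ⟨x, hx, hx0, hlab, hrange⟩ := exists_coordinates_isEvaluation (B := B) n
      (fun i => c (s.succAbove i)) (fun i j => prec (s.succAbove i) (s.succAbove j))
      fun i j h => hc _ _ h
    have hG : canonicalGraph (n + 1) prec = (canonicalGraph n
        fun i j => prec (s.succAbove i) (s.succAbove j)).fusion s := by rw [hs]; rfl
    rw [hG, extremePoints_KSet hc hs, ← hrange]
    clear hrange hG
    generalize canonicalGraph n (fun i j => prec (s.succAbove i) (s.succAbove j)) = G at *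
    clear hs
    set cs : ℚ := (Fin.snoc (fun i => (c (s.succAbove i) : ℚ)) 0 : Fin (n + 1) → ℚ) s with hcs
    set L : (Fin n → ℚ) → ℚ := fun x => (Fin.cons 0 x : Fin (n + 1) → ℚ) s with hL
    set U : (Fin n → ℚ) → ℚ := fun x => (Fin.snoc x 0 : Fin (n + 1) → ℚ) s + (c s - cs) with hU
    -- The top label exceeds `s`, so the chain starts in `𝒢⁺`, where the lift by `L` preserves zero.
    have hlast : ∀ p, (G.fusion s).IsPointedChain p →
        ∃ v, p (Fin.last (n + 1)) = .inl v ∧ x v = 0 := by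
      intro p hp
      obtain ⟨p, hp', rfl⟩ := LabelledGraph.IsPointedChain.exists_eq_fusionChain hp
      refine ⟨p (Fin.last n), ?_, hx0 p hp'⟩
      rw [LabelledGraph.fusionChain, if_pos (Fin.castSucc_lt_last s), Fin.predAbove_right_last]
    have hinl : ∀ (r : Fin (n + 2) → Module.Dual ℚ B) (x : Fin n → ℚ),
        coordFunction r (s.insertNth (L x) x : Fin (n + 1) → ℚ) =
          coordFunction (r ∘ s.castSucc.succAbove) x := by
      intro r x
      rw [coordFunction_insertNth, sub_self, zero_smul, add_zero]
    have hinr : ∀ (r : Fin (n + 2) → Module.Dual ℚ B) (x : Fin n → ℚ),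
        coordFunction r (s.insertNth (U x) x : Fin (n + 1) → ℚ) =
          coordFunction (r ∘ s.succ.succAbove) x +
            ((c s : ℚ) - cs) • (r s.castSucc - r s.succ) := by
      intro r x
      rw [coordFunction_insertNth, sub_eq_iff_eq_add.1 (coordFunction_succAbove_sub r s x),
        ← neg_sub (r s.castSucc), smul_neg, neg_add_eq_sub, dualCoeff, hU]
      module
    have hz : ∀ x : Fin n → ℚ, x = 0 → (s.insertNth (L x) x : Fin (n + 1) → ℚ) = 0 := by
      rintro x rfl
      have : L 0 = 0 := by
        simp only [hL]
        induction s using Fin.cases <;> simp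
      rw [this]
      funext k
      rcases Fin.eq_self_or_eq_succAbove s k with rfl | ⟨q, rfl⟩ <;> simp
    refine ⟨Sum.elim (fun v => s.insertNth (L (x v)) (x v)) (fun v => s.insertNth (U (x v)) (x v)),
      fun r => ⟨fun k v w h => ?_, fun p hp => ?_⟩, fun p hp => ?_, fun v => ?_, ?_⟩
    · have hcross : ∀ v, s.castSucc.succAbove (G.label v) = s.succ →
          coordFunction r (s.insertNth (L (x v)) (x v) : Fin (n + 1) → ℚ) -
            coordFunction r (s.insertNth (U (x v)) (x v) : Fin (n + 1) → ℚ) =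
          (c s : ℚ) • (r s.succ - r s.castSucc) := by
        intro v hv
        have hv' := (castSucc_succAbove_eq_succ_iff _ _).1 hv
        have hd := hlab v
        rw [hv'] at hd
        rw [hinl, hinr, sub_eq_iff_eq_add.1 (coordFunction_succAbove_sub r s (x v)), hd, ← hcs]
        module
      have hlr : ∀ v, s.castSucc.succAbove (G.label v) = s.succ →
          s.succ.succAbove (G.label v) = s.castSucc := by
        intro v hv
        rw [(castSucc_succAbove_eq_succ_iff _ _).1 hv, Fin.succAbove_succ_self]
      rcases v with v | v <;> rcases w with w | w
      · obtain ⟨q, rfl, h⟩ := h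
        have := (hx (r ∘ s.castSucc.succAbove)).1 q v w h
        simp only [Sum.elim_inl, hinl]
        exact this
      · obtain ⟨rfl, rfl, h⟩ := h
        simpa only [Sum.elim_inl, Sum.elim_inr, LabelledGraph.fusion, h, hlr v h] using hcross v h
      · obtain ⟨rfl, rfl, h⟩ := h
        simp only [Sum.elim_inl, Sum.elim_inr, LabelledGraph.fusion, h, hlr v h]
        rw [← neg_sub, hcross v h, ← smul_neg, neg_sub]
      · obtain ⟨q, rfl, h⟩ := h
        have := (hx (r ∘ s.succ.succAbove)).1 q v w h
        simp only [Sum.elim_inr, hinr, add_sub_add_right_eq_sub]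
        exact this
    · obtain ⟨v, hv, hv0⟩ := hlast p hp
      simp only [hv, Sum.elim_inl]
      rw [hz _ hv0]
      simp [coordFunction]
    · obtain ⟨v, hv, hv0⟩ := hlast p hp
      rw [hv, Sum.elim_inl, hz _ hv0]
    · have hc' : (fun i => (c i : ℚ)) =
          (s.insertNth (c s : ℚ) fun i => (c (s.succAbove i) : ℚ)) :=
        (Fin.insertNth_self_removeNth s (fun i => (c i : ℚ))).symm
      rw [hc']
      rcases v with v | v
      · simp only [LabelledGraph.fusion, Sum.elim_inl, hL]
        rw [dualCoeff_insertNth_succAbove_castSucc, snoc_insertNth_succAbove, hlab]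
      · simp only [LabelledGraph.fusion, Sum.elim_inr, hU]
        rw [dualCoeff_insertNth_succAbove_succ, hlab]
        -- A vertex of `𝒢⁻` labelled `s` has coefficient `cs + (c s - cs)`; at other labels the
        -- shift has no effect.
        split_ifs with h
        · rw [h, Fin.succAbove_succ_self, Fin.snoc_castSucc, Fin.insertNth_apply_same, hcs]
          ring
        · have := snoc_insertNth_succAbove s (c s : ℚ) 0 (fun i => (c (s.succAbove i) : ℚ))
            (G.label v)
          rw [castSucc_succAbove_eq_ite, if_neg h] at this
          rw [this, add_zero]
    · change Set.range (Sum.elim _ _) = _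
      rw [Set.Sum.elim_range, ← Set.range_comp, ← Set.range_comp]
      rfl

theorem theorem1p4 {B : Type*} [AddCommGroup B] [Module ℚ B] (n : ℕ) (c : Fin n → ℕ)
    (prec : Fin n → Fin n → Prop) [IsStrictTotalOrder (Fin n) prec]
    (hc : ∀ i j, prec i j → c i ≤ c j)
    (r : Fin (n + 1) → Module.Dual ℚ B) (hr : LinearIndependent ℚ r) :
    (∃! p, (canonicalGraph n prec).IsPointedChain p) ∧
    (∃! z, (canonicalGraph n prec).IsEvaluation c r z) ∧
    Function.Injective (coordFunction r) ∧
    coordFunction r '' (Set.extremePoints ℚ (KSet c prec)) = ZSet c prec r := by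
  obtain ⟨x, hx, -, -, hrange⟩ := exists_coordinates_isEvaluation (B := B) n c prec hc
  refine ⟨LabelledGraph.existsUnique_isPointedChain n prec, ⟨_, hx r, fun z hz => hz.eq (hx r)⟩,
    coordFunction_injective hr, ?_⟩
  rw [← hrange, ← Set.range_comp]
  ext f
  constructor
  · rintro ⟨v, rfl⟩
    exact ⟨_, hx r, v, rfl⟩
  · rintro ⟨z, hz, v, rfl⟩
    rw [hz.eq (hx r)]
    exact ⟨v, rfl⟩
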